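/- Let $d,w\ge 1$, $D=dw$, $Q\ge 0$ and $\alpha\in(0,1]$. For a reflection $R$ on $\mathbb C^d$ (a unitary with $R^2=I$) put $R^\alpha=\tfrac12(I+R)+e^{-\mathrm i\pi\alpha}\tfrac12(I-R)$. Let $\mathcal C$ be an oracle circuit on $\mathbb C^D=\mathbb C^d\otimes\mathbb C^w$, that is, a finite sequence of gates, each of which is either a fixed unitary on $\mathbb C^D$ or a query to the oracle $Z$ or $Z^\dagger$ acting on the factor $\mathbb C^d$, and suppose that it makes exactly $Q$ queries. Write $\mathcal C(Z)\in \mathrm U(D)$ for the unitary that it implements when the oracle is $Z\in\mathrm U(d)$. Then there is an oracle circuit $\mathcal C'$ on $(\mathbb C^2)^{\otimes Q}\otimes\mathbb C^D$ (with $Q$ ancilla qubits), which depends on $\mathcal C$ and $\alpha$ but not on $R$, and which consists of fixed unitaries and at most $50+100\alpha Q$ queries to controlled-$R$, $|0\rangle\langle 0|\otimes I+|1\rangle\langle 1|\otimes R$ (with one of the ancilla qubits as control and the factor $\mathbb C^d$ as target), such that the following holds for every reflection $R\in \mathrm U(d)$. Let $\mathcal C_R\in\mathrm U(2^QD)$ be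 the unitary that $\mathcal C'$ implements with this $R$. For every unit vector $|\psi\rangle\in\mathbb C^D$ there are a scalar $\nu\in\mathbb C$, a unit vector $|\widetilde{\mathrm{out}}\rangle\in\mathbb C^D$ and a vector $|\Phi^\perp\rangle$ with $(\langle 0|^{\otimes Q}\otimes I)|\Phi^\perp\rangle=0$ such that $$\mathcal C_R\,|0\rangle^{\otimes Q}|\psi\rangle=\nu\,|0\rangle^{\otimes Q}|\widetilde{\mathrm{out}}\rangle+|\Phi^\perp\rangle,$$ $$|\nu|\ge 0.99\exp\!\left(-\alpha\pi\tfrac Q2\right)\qquad\text{and}\qquad \left\||\widetilde{\mathrm{out}}\rangle-\mathcal C(R^\alpha)|\psi\rangle\right\|_2<\exp(-99\alpha\pi Q-20).$$ -/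

import Mathlib

open scoped Matrix Kronecker

noncomputable section

namespace QueryCircuit

/-- A gate of an oracle circuit on the Hilbert space with computational basis `n`: either a fixed
unitary on the whole space (independent of the oracle), or an oracle query with label `q`. -/
inductive Gate (n : Type*) [Fintype n] [DecidableEq n] (q : Type*)
  | unitary (U : Matrix.unitaryGroup n ℂ) : Gate n q
  | query (a : q) : Gate n q

/-- An oracle circuit: the list of its gates, in the order in which they are applied. -/
abbrev Circuit (n : Type*) [Fintype n] [DecidableEq n] (q : Type*) := List (Gate n q)

variable {n : Type*} [Fintype n] [DecidableEq n] {q : Type*}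

/-- The operator of a gate, given the operators answering the queries. -/
def Gate.eval (oracle : q → Matrix n n ℂ) : Gate n q → Matrix n n ℂ
  | .unitary U => (U : Matrix n n ℂ)
  | .query a => oracle a

/-- The operator implemented by a circuit: the first gate of the list acts first. -/
def Circuit.eval (oracle : q → Matrix n n ℂ) : Circuit n q → Matrix n n ℂ
  | [] => 1
  | g :: gs => Circuit.eval oracle gs * g.eval oracle

/-- The number of oracle queries made by a circuit. -/
def Circuit.queryCount : Circuit n q → ℕ
  | [] => 0
  | .unitary _ :: gs => Circuit.queryCount gs
  | .query _ :: gs => Circuit.queryCount gs + 1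

/-- The fractional power `R ^ α = (1 + R) / 2 + exp (-iπα) (1 - R) / 2` of a reflection `R`. -/
def fracPow {d : ℕ} (R : Matrix (Fin d) (Fin d) ℂ) (α : ℝ) : Matrix (Fin d) (Fin d) ℂ :=
  (1 / 2 : ℂ) • (1 + R) +
    (Complex.exp (-(Complex.I * (Real.pi : ℂ) * (α : ℂ))) * (1 / 2 : ℂ)) • (1 - R)

/-- The two queries to `Z`, acting on the `d`-dimensional register of `ℂ^d ⊗ ℂ^W`:
label `false` is `Z ⊗ I` and label `true` is `Z† ⊗ I`. -/
def fracOracle {d : ℕ} {W : Type*} [DecidableEq W] (Z : Matrix (Fin d) (Fin d) ℂ) :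
    Bool → Matrix (Fin d × W) (Fin d × W) ℂ
  | false => Z ⊗ₖ (1 : Matrix W W ℂ)
  | true => Zᴴ ⊗ₖ (1 : Matrix W W ℂ)

/-- The queries to controlled-`R` on `(ℂ²)^{⊗ Q} ⊗ (ℂ^d ⊗ ℂ^W)`: the label `i` is the ancilla qubit
used as the control, so the operator is `|0⟩⟨0|_i ⊗ I + |1⟩⟨1|_i ⊗ R`. -/
def ctrlOracle {d : ℕ} {W : Type*} [DecidableEq W] (Q : ℕ) (R : Matrix (Fin d) (Fin d) ℂ)
    (i : Fin Q) :
    Matrix ((Fin Q → Fin 2) × (Fin d × W)) ((Fin Q → Fin 2) × (Fin d × W)) ℂ :=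
  (Matrix.diagonal fun b : Fin Q → Fin 2 => if b i = 0 then (1 : ℂ) else 0) ⊗ₖ
      (1 : Matrix (Fin d × W) (Fin d × W) ℂ) +
    (Matrix.diagonal fun b : Fin Q → Fin 2 => if b i = 1 then (1 : ℂ) else 0) ⊗ₖ
      (R ⊗ₖ (1 : Matrix W W ℂ))

/-- A matrix acting on a vector of the Euclidean space `ℂ^n`. -/
def act (M : Matrix n n ℂ) (v : EuclideanSpace ℂ n) : EuclideanSpace ℂ n :=
  WithLp.toLp 2 (M *ᵥ v.ofLp)

/-- The vector `|0⟩^{⊗ Q} ⊗ v`. -/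
def zeroKet {m : Type*} (Q : ℕ) (v : EuclideanSpace ℂ m) :
    EuclideanSpace ℂ ((Fin Q → Fin 2) × m) :=
  WithLp.toLp 2 fun p => if p.1 = 0 then v p.2 else 0

/-- The vector `(⟨0|^{⊗ Q} ⊗ I) Φ`. -/
def zeroBra {m : Type*} (Q : ℕ) (Φ : EuclideanSpace ℂ ((Fin Q → Fin 2) × m)) :
    EuclideanSpace ℂ m :=
  WithLp.toLp 2 fun x => Φ (0, x)

end QueryCircuit

end

/-!
Each answer `R ^ {±α}` is `c₀ I + c₁ R`, so `C` becomes a sum, over bit strings `b` recording which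
queries contribute `R`, of words in `R` with as many letters `R` as `b` has ones. A linear
combination of unitaries implements this sum on the ancillas. Its weights are products of the `cᵢ`,
with `|c₀| ≤ 1` and `|c₁| ≤ πα/2`, so they concentrate on small Hamming weight: a Chernoff bound
with parameter `e⁴` shows that words may be cut after about `49 + 100 * α * Q` letters.

To make do with `Q` ancillas, the qubit `0` implements the first query by a linear combination of
its own. On the postselected branch it is then back in `|0⟩`, and it serves as the control of all
the later queries: the bit string in the other `Q - 1` qubits determines whether it is flipped
around a query, that is, whether the next letter of the word is applied.
-/

noncomputable section

namespace QueryCircuit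

section Block

variable {B m R : Type*}

/-- The block `(⟨b| ⊗ I) M (|c⟩ ⊗ I)` of an operator on the registers `B` and `m`. -/
def block (M : Matrix (B × m) (B × m) R) (b c : B) : Matrix m m R :=
  (Matrix.comp B B m m R).symm M b c

theorem ext_block {M N : Matrix (B × m) (B × m) R} (h : ∀ b c, block M b c = block N b c) :
    M = N :=
  Matrix.ext fun i j => congrFun₂ (h i.1 j.1) i.2 j.2

theorem block_mul [Fintype B] [Fintype m] [NonUnitalNonAssocSemiring R]
    (M N : Matrix (B × m) (B × m) R) (b c : B) :
    block (M * N) b c = ∑ a, block M b a * block N a c :=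
  congrFun₂ (map_mul (Matrix.compRingEquiv B m R).symm M N) b c

theorem block_kronecker_one [DecidableEq m] [CommSemiring R] (A : Matrix B B R) (b c : B) :
    block (A ⊗ₖ (1 : Matrix m m R)) b c = A b c • (1 : Matrix m m R) := by
  ext x y
  simp [block]

variable [DecidableEq B]

/-- The operator `∑ b, |b⟩⟨b| ⊗ u b`: it applies `u b` to the register `m` conditioned on the basis
state `b` of the register `B`. -/
def select [Zero R] (u : B → Matrix m m R) : Matrix (B × m) (B × m) R :=
  Matrix.comp B B m m R (Matrix.diagonal u)

theorem block_select [Zero R] (u : B → Matrix m m R) (b c : B) :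
    block (select u) b c = if b = c then u b else 0 := by
  simp [block, select, Matrix.diagonal_apply]

theorem star_select [NonUnitalNonAssocSemiring R] [StarRing R] (u : B → Matrix m m R) :
    star (select u) = select fun b => star (u b) :=
  congrArg (Matrix.comp B B m m R) (Matrix.diagonal_conjTranspose u)

theorem select_one [DecidableEq m] [Zero R] [One R] :
    select (fun _ : B => (1 : Matrix m m R)) = 1 := by
  rw [select, Matrix.diagonal_one, Matrix.comp_one]

variable [Fintype B] [Fintype m]

theorem select_mul_select [NonUnitalNonAssocSemiring R] (u v : B → Matrix m m R) :
    select u * select v = select fun b => u b * v b := by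
  simp only [select, ← Matrix.compRingEquiv_apply, ← map_mul, Matrix.diagonal_mul_diagonal]

variable [DecidableEq m]

theorem select_mem_unitaryGroup [CommRing R] [StarRing R] (u : B → Matrix.unitaryGroup m R) :
    select (fun b => (u b : Matrix m m R)) ∈ Matrix.unitaryGroup (B × m) R := by
  rw [Matrix.mem_unitaryGroup_iff, star_select, select_mul_select]
  simp only [Unitary.mul_star_self_of_mem (u _).2, select_one]

theorem block_kronecker_mul_select_mul_kronecker [CommSemiring R] (A A' : Matrix B B R)
    (u : B → Matrix m m R) (b c : B) :
    block (A' ⊗ₖ (1 : Matrix m m R) * select u * A ⊗ₖ (1 : Matrix m m R)) b c =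
      ∑ a, (A' b a * A a c) • u a := by
  simp [block_mul, block_select, block_kronecker_one, smul_smul, mul_comm]

end Block

section Prepare

variable {B 𝕜 : Type*} [Fintype B] [DecidableEq B] [RCLike 𝕜]

theorem exists_unitary_col_eq (v : EuclideanSpace 𝕜 B) (hv : ‖v‖ = 1) (b₀ : B) :
    ∃ A : Matrix.unitaryGroup B 𝕜, ∀ b, A b b₀ = v b := by
  have hv' : Orthonormal 𝕜 (({b₀} : Set B).domRestrict fun _ => v) :=
    ⟨fun _ => hv, fun i j hij => absurd (Subsingleton.elim i j) hij⟩
  obtain ⟨e, he⟩ := hv'.exists_orthonormalBasis_extension_of_card_eq (by simp)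
  refine ⟨⟨(EuclideanSpace.basisFun B 𝕜).toBasis.toMatrix e,
    (EuclideanSpace.basisFun B 𝕜).toMatrix_orthonormalBasis_mem_unitary e⟩, fun b => ?_⟩
  simp [Module.Basis.toMatrix_apply, he b₀ rfl]

theorem exists_unitary_row_eq (v : EuclideanSpace 𝕜 B) (hv : ‖v‖ = 1) (b₀ : B) :
    ∃ A : Matrix.unitaryGroup B 𝕜, ∀ b, A b₀ b = v b := by
  obtain ⟨A, hA⟩ := exists_unitary_col_eq (WithLp.toLp 2 (star v.ofLp))
    (by simpa [EuclideanSpace.norm_eq] using hv) b₀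
  exact ⟨star A, fun b => by simp [Matrix.star_apply, hA]⟩

theorem exists_unitary_row_mul_col_eq (w : B → 𝕜) (hw : 0 < ∑ b, ‖w b‖) (b₀ : B) :
    ∃ A A' : Matrix.unitaryGroup B 𝕜, ∀ b,
      A' b₀ b * A b b₀ = ((∑ b, ‖w b‖ : ℝ) : 𝕜)⁻¹ * w b := by
  set N := ∑ b, ‖w b‖ with hN
  have norm_eq_one : ∀ v : B → 𝕜, (∀ b, ‖v b‖ ^ 2 = ‖w b‖ / N) → ‖WithLp.toLp 2 v‖ = 1 := by
    intro v hv
    simp only [EuclideanSpace.norm_eq, hv, ← Finset.sum_div, ← hN, div_self hw.ne', Real.sqrt_one]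
  -- at `w b = 0` the entry of the row is `0 / 0 = 0`
  obtain ⟨A, hA⟩ := exists_unitary_col_eq (WithLp.toLp 2 fun b => (√(‖w b‖ / N) : 𝕜))
    (norm_eq_one _ fun b => by
      rw [RCLike.norm_ofReal, sq_abs, Real.sq_sqrt (by positivity)]) b₀
  obtain ⟨A', hA'⟩ := exists_unitary_row_eq (WithLp.toLp 2 fun b => w b / (√(‖w b‖ * N) : 𝕜))
    (norm_eq_one _ fun b => by
      rw [norm_div, RCLike.norm_ofReal, div_pow, sq_abs, Real.sq_sqrt (by positivity)]
      field_simp) b₀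
  refine ⟨A, A', fun b => ?_⟩
  rcases eq_or_ne (w b) 0 with hb | hb
  · simp [hA', hb]
  · have hsqrt : √(‖w b‖ / N) / √(‖w b‖ * N) = N⁻¹ := by
      have : ‖w b‖ / N / (‖w b‖ * N) = N⁻¹ ^ 2 := by
        have := norm_ne_zero_iff.mpr hb
        field_simp
      rw [← Real.sqrt_div (by positivity), this, Real.sqrt_sq (by positivity)]
    rw [hA, hA', div_mul_eq_mul_div, mul_div_assoc, ← RCLike.ofReal_div, hsqrt, RCLike.ofReal_inv,
      mul_comm]

end Prepare

section Circuit

variable {n q : Type*} [Fintype n] [DecidableEq n]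

theorem Circuit.eval_append (o : q → Matrix n n ℂ) (C D : Circuit n q) :
    Circuit.eval o (C ++ D) = D.eval o * C.eval o := by
  induction C with
  | nil => simp [Circuit.eval]
  | cons g C ih => simp only [List.cons_append, Circuit.eval, ih, Matrix.mul_assoc]

theorem Circuit.queryCount_append (C D : Circuit n q) :
    Circuit.queryCount (C ++ D) = C.queryCount + D.queryCount := by
  induction C with
  | nil => simp [Circuit.queryCount]
  | cons g C ih => cases g <;> simp only [List.cons_append, Circuit.queryCount, ih]; omega

theorem Circuit.eval_mem_unitaryGroup {o : q → Matrix n n ℂ}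
    (ho : ∀ a, o a ∈ Matrix.unitaryGroup n ℂ) (C : Circuit n q) :
    C.eval o ∈ Matrix.unitaryGroup n ℂ := by
  induction C with
  | nil => exact one_mem _
  | cons g C ih =>
    cases g with
    | unitary U => exact mul_mem ih U.2
    | query a => exact mul_mem ih (ho a)

theorem Circuit.exists_unitary_of_queryCount_eq_zero (C : Circuit n q) (hC : C.queryCount = 0) :
    ∃ U : Matrix.unitaryGroup n ℂ, ∀ o, C.eval o = U := by
  induction C with
  | nil => exact ⟨1, fun o => rfl⟩
  | cons g C ih =>
    cases g with
    | unitary V =>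
      obtain ⟨U, hU⟩ := ih hC
      exact ⟨U * V, fun o => by simp [Circuit.eval, Gate.eval, hU]⟩
    | query a => simp [Circuit.queryCount] at hC

theorem Circuit.exists_first_query {P : ℕ} (C : Circuit n q) (hC : C.queryCount = P + 1) :
    ∃ (U : Matrix.unitaryGroup n ℂ) (a : q) (D : Circuit n q), D.queryCount = P ∧
      ∀ o, C.eval o = D.eval o * o a * U := by
  induction C with
  | nil => simp [Circuit.queryCount] at hC
  | cons g C ih =>
    cases g with
    | unitary V =>
      obtain ⟨U, a, D, hD, hCD⟩ := ih hC
      exact ⟨U * V, a, D, hD, fun o => by simp [Circuit.eval, Gate.eval, hCD, Matrix.mul_assoc]⟩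
    | query a =>
      exact ⟨1, a, C, by simpa [Circuit.queryCount] using hC,
        fun o => by simp [Circuit.eval, Gate.eval]⟩

end Circuit

section Interleave

variable {n q : Type*} [Fintype n] [DecidableEq n]

/-- The word `g k * S * g (k - 1) * ⋯ * S * g 0` with `k` occurrences of the letter `S`. -/
def interleave (S : Matrix n n ℂ) (g : ℕ → Matrix.unitaryGroup n ℂ) : ℕ → Matrix n n ℂ
  | 0 => g 0
  | k + 1 => g (k + 1) * S * interleave S g k

theorem interleave_succ_eq_mul (S : Matrix n n ℂ) (g : ℕ → Matrix.unitaryGroup n ℂ) (k : ℕ) :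
    interleave S g (k + 1) = interleave S (fun j => g (j + 1)) k * S * g 0 := by
  induction k with
  | zero => rfl
  | succ k ih => rw [interleave, ih, interleave]; simp only [Matrix.mul_assoc]

theorem interleave_update_zero (S : Matrix n n ℂ) (g : ℕ → Matrix.unitaryGroup n ℂ)
    (U : Matrix.unitaryGroup n ℂ) (k : ℕ) :
    interleave S (Function.update g 0 (g 0 * U)) k = interleave S g k * U := by
  induction k with
  | zero => simp [interleave]
  | succ k ih => simp [interleave, ih, Matrix.mul_assoc]

theorem sum_fin_succ_pi {α M : Type*} [Fintype α] [AddCommMonoid M] {P : ℕ}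
    (f : (Fin (P + 1) → α) → M) : ∑ b, f b = ∑ h, ∑ b : Fin P → α, f (Fin.cons h b) := by
  rw [← Fintype.sum_prod_type']
  exact ((Fin.consEquiv fun _ => α).sum_comp f).symm

theorem hammingNorm_cons {α : Type*} [Zero α] [DecidableEq α] {P : ℕ} (h : α) (b : Fin P → α) :
    hammingNorm (Fin.cons h b : Fin (P + 1) → α) = hammingNorm b + if h = 0 then 0 else 1 := by
  by_cases hh : h = 0 <;> simp [hammingNorm, Fin.card_filter_univ_succ, hh]

theorem Circuit.exists_eval_eq_sum_interleave {P : ℕ} (C : Circuit n q) (hC : C.queryCount = P) :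
    ∃ (l : Fin P → q) (g : (Fin P → Fin 2) → ℕ → Matrix.unitaryGroup n ℂ),
      ∀ (o : q → Matrix n n ℂ) (S : Matrix n n ℂ) (z : q → Fin 2 → ℂ),
        (∀ a, o a = z a 0 • (1 : Matrix n n ℂ) + z a 1 • S) →
          C.eval o = ∑ b, (∏ i, z (l i) (b i)) • interleave S (g b) (hammingNorm b) := by
  induction P generalizing C with
  | zero =>
    obtain ⟨U, hU⟩ := C.exists_unitary_of_queryCount_eq_zero hC
    exact ⟨Fin.elim0, fun _ _ => U, fun o S z _ => by simp [hU, hammingNorm, interleave]⟩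
  | succ P ih =>
    obtain ⟨U, a, D, hD, hCD⟩ := C.exists_first_query hC
    obtain ⟨l, g, hg⟩ := ih D hD
    refine ⟨Fin.cons a l, fun b =>
      if b 0 = 0 then Function.update (g (Fin.tail b)) 0 (g (Fin.tail b) 0 * U)
      else fun j => Nat.casesOn j U (g (Fin.tail b)), fun o S z ho => ?_⟩
    simp only [sum_fin_succ_pi, Fin.sum_univ_two, Fin.prod_univ_succ, Fin.cons_zero, Fin.cons_succ,
      Fin.tail_cons, hammingNorm_cons, if_true, one_ne_zero, if_false, add_zero,
      interleave_update_zero, interleave_succ_eq_mul, ← Finset.sum_add_distrib]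
    rw [hCD, hg o S z ho, ho, Finset.sum_mul, Finset.sum_mul]
    refine Finset.sum_congr rfl fun b _ => ?_
    simp only [mul_add, add_mul, mul_smul, smul_mul_assoc, mul_smul_comm, mul_one]
    rfl

open scoped Matrix.Norms.L2Operator

theorem norm_unitary_le_one (U : Matrix.unitaryGroup n ℂ) : ‖(U : Matrix n n ℂ)‖ ≤ 1 := by
  cases isEmpty_or_nonempty n
  · simp [Subsingleton.elim (U : Matrix n n ℂ) 0]
  · exact (CStarRing.norm_coe_unitary U).le

theorem norm_interleave_le_one {S : Matrix n n ℂ} (hS : ‖S‖ ≤ 1)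
    (g : ℕ → Matrix.unitaryGroup n ℂ) (k : ℕ) : ‖interleave S g k‖ ≤ 1 := by
  induction k with
  | zero => exact norm_unitary_le_one _
  | succ k ih =>
    calc ‖interleave S g (k + 1)‖ ≤ ‖(g (k + 1) : Matrix n n ℂ)‖ * ‖S‖ * ‖interleave S g k‖ :=
          norm_mul₃_le
      _ ≤ 1 * 1 * 1 := by gcongr; exact norm_unitary_le_one _
      _ = 1 := by norm_num

end Interleave

section Gates

theorem submatrix_mem_unitaryGroup {B B' R : Type*} [Fintype B] [DecidableEq B] [Fintype B']
    [DecidableEq B'] [CommRing R] [StarRing R] {M : Matrix B B R} (hM : M ∈ Matrix.unitaryGroup B R)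
    (e : B' ≃ B) : M.submatrix e e ∈ Matrix.unitaryGroup B' R := by
  rw [Matrix.mem_unitaryGroup_iff, Matrix.star_eq_conjTranspose] at hM ⊢
  rw [Matrix.conjTranspose_submatrix, Matrix.submatrix_mul_equiv, hM, Matrix.submatrix_one_equiv]

variable {B m q : Type*} [Fintype B] [DecidableEq B] [Fintype m] [DecidableEq m]

theorem permMatrix_mem_unitaryGroup {R : Type*} [CommRing R] [StarRing R] (σ : Equiv.Perm B) :
    σ.permMatrix R ∈ Matrix.unitaryGroup B R := by
  rw [Matrix.mem_unitaryGroup_iff, Matrix.star_eq_conjTranspose, Matrix.conjTranspose_permMatrix,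
    ← Matrix.permMatrix_mul, inv_mul_cancel, Matrix.permMatrix_one]

/-- The gate `∑ b, |b⟩⟨b| ⊗ u b`. -/
def selectGate (u : B → Matrix.unitaryGroup m ℂ) : Gate (B × m) q :=
  .unitary ⟨select fun b => u b, select_mem_unitaryGroup u⟩

/-- The gate `A ⊗ I` acting on the register `B`. -/
def registerGate (A : Matrix.unitaryGroup B ℂ) : Gate (B × m) q :=
  .unitary ⟨(A : Matrix B B ℂ) ⊗ₖ (1 : Matrix m m ℂ), Matrix.kronecker_mem_unitary A.2 (one_mem _)⟩

/-- A query to `o a` between two permutations of the basis states of the register `B`, which turn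
an operator `∑ b, |b⟩⟨b| ⊗ u b` into `∑ b, |b⟩⟨b| ⊗ u (σ b)`. -/
def permutedQuery (σ : Equiv.Perm B) (a : q) : Circuit (B × m) q :=
  [registerGate ⟨σ⁻¹.permMatrix ℂ, permMatrix_mem_unitaryGroup σ⁻¹⟩, .query a,
    registerGate ⟨σ.permMatrix ℂ, permMatrix_mem_unitaryGroup σ⟩]

theorem eval_permutedQuery (σ : Equiv.Perm B) {o : q → Matrix (B × m) (B × m) ℂ} {a : q}
    {u : B → Matrix m m ℂ} (ho : o a = select u) :
    Circuit.eval o (permutedQuery σ a) = select (u ∘ σ) := by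
  simp only [permutedQuery, Circuit.eval, Gate.eval, registerGate, ho, one_mul]
  refine ext_block fun b c => ?_
  rw [block_kronecker_mul_select_mul_kronecker, block_select]
  simp [PEquiv.toMatrix_apply, ite_smul, Equiv.Perm.permMatrix, Finset.sum_ite]

end Gates

section HeadTail

theorem tail_zero {α : Type*} [Zero α] {P : ℕ} : Fin.tail (0 : Fin (P + 1) → α) = 0 :=
  rfl

variable {P : ℕ}

/-- The unitary `G ⊗ V` on `P + 1` qubits, where `G` acts on the qubit `0`. -/
def headTail (G : Matrix.unitaryGroup (Fin 2) ℂ) (V : Matrix.unitaryGroup (Fin P → Fin 2) ℂ) :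
    Matrix.unitaryGroup (Fin (P + 1) → Fin 2) ℂ :=
  ⟨((G : Matrix _ _ ℂ) ⊗ₖ (V : Matrix _ _ ℂ)).submatrix (Fin.consEquiv fun _ => Fin 2).symm
      (Fin.consEquiv fun _ => Fin 2).symm, by
    have hGV := Matrix.kronecker_mem_unitary G.2 V.2
    exact submatrix_mem_unitaryGroup hGV _⟩

theorem headTail_apply (G : Matrix.unitaryGroup (Fin 2) ℂ)
    (V : Matrix.unitaryGroup (Fin P → Fin 2) ℂ) (b c : Fin (P + 1) → Fin 2) :
    headTail G V b c = G (b 0) (c 0) * V (Fin.tail b) (Fin.tail c) :=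
  rfl

variable {m : Type*} [Fintype m] [DecidableEq m]

theorem block_conj_headTail_one (G G' : Matrix.unitaryGroup (Fin 2) ℂ)
    (u : (Fin (P + 1) → Fin 2) → Matrix m m ℂ) (c : Fin (P + 1) → Fin 2) :
    block ((headTail (P := P) G' 1 : Matrix _ _ ℂ) ⊗ₖ (1 : Matrix m m ℂ) * select u *
        (headTail (P := P) G 1 : Matrix _ _ ℂ) ⊗ₖ (1 : Matrix m m ℂ)) c 0 =
      if Fin.tail c = 0 then
        ∑ h, (G' (c 0) h * G h 0) • u (Fin.cons h 0)
      else 0 := by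
  rw [block_kronecker_mul_select_mul_kronecker, sum_fin_succ_pi]
  simp only [headTail_apply, Fin.cons_zero, Fin.tail_cons, Pi.zero_apply, tail_zero,
    OneMemClass.coe_one, Matrix.one_apply]
  split_ifs with hc <;> simp [hc, ite_smul]

theorem block_conj_one_headTail (V V' : Matrix.unitaryGroup (Fin P → Fin 2) ℂ)
    (u : (Fin (P + 1) → Fin 2) → Matrix m m ℂ) (c : Fin (P + 1) → Fin 2) :
    block ((headTail 1 V' : Matrix _ _ ℂ) ⊗ₖ (1 : Matrix m m ℂ) * select u *
        (headTail 1 V : Matrix _ _ ℂ) ⊗ₖ (1 : Matrix m m ℂ)) 0 c =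
      if c 0 = 0 then
        ∑ b, (V' 0 b * V b (Fin.tail c)) • u (Fin.cons 0 b)
      else 0 := by
  rw [block_kronecker_mul_select_mul_kronecker, sum_fin_succ_pi]
  simp only [headTail_apply, Fin.cons_zero, Fin.tail_cons, Pi.zero_apply, tail_zero,
    OneMemClass.coe_one, Matrix.one_apply]
  split_ifs with hc <;> simp [hc, ite_smul, eq_comm]

end HeadTail

section Truncate

variable {P : ℕ} {m : Type*} [Fintype m] [DecidableEq m]

/-- The oracle answering the query `i` by `|0⟩⟨0|ᵢ ⊗ I + |1⟩⟨1|ᵢ ⊗ S`. -/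
def controlled {Q : ℕ} (S : Matrix m m ℂ) (i : Fin Q) :
    Matrix ((Fin Q → Fin 2) × m) ((Fin Q → Fin 2) × m) ℂ :=
  select fun b => if b i = 0 then 1 else S

/-- Flips the qubit `0` if the Hamming weight of the other qubits exceeds `k`. -/
def thresholdFlip (k : ℕ) : Equiv.Perm (Fin (P + 1) → Fin 2) :=
  Function.Involutive.toPerm
    (fun b => Fin.cons (b 0 + if k < hammingNorm (Fin.tail b) then 1 else 0) (Fin.tail b))
    fun b => by
      have add_self (c : Fin 2) : c + c = 0 := by decide +revert
      simp only [Fin.cons_zero, Fin.tail_cons, add_assoc, add_self, add_zero, Fin.cons_self_tail]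

theorem thresholdFlip_cons_zero (k : ℕ) (b : Fin P → Fin 2) :
    (thresholdFlip k (Fin.cons 0 b) : Fin (P + 1) → Fin 2) 0 =
      if k < hammingNorm b then 1 else 0 := by
  simp [thresholdFlip, Function.Involutive.toPerm]

/-- The circuit with `k` queries which acts as `interleave S (g b) (min k (hammingNorm b))` if the
qubit `0` is in the state `|0⟩` and the other qubits are in the state `|b⟩`. -/
def truncatedInterleave (g : (Fin P → Fin 2) → ℕ → Matrix.unitaryGroup m ℂ) :
    ℕ → Circuit ((Fin (P + 1) → Fin 2) × m) (Fin (P + 1))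
  | 0 => [selectGate fun b => g (Fin.tail b) 0]
  | k + 1 => truncatedInterleave g k ++ permutedQuery (thresholdFlip k) 0 ++
      [selectGate fun b => if k < hammingNorm (Fin.tail b) then g (Fin.tail b) (k + 1) else 1]

theorem queryCount_truncatedInterleave (g : (Fin P → Fin 2) → ℕ → Matrix.unitaryGroup m ℂ)
    (k : ℕ) : (truncatedInterleave g k).queryCount = k := by
  induction k with
  | zero => rfl
  | succ k ih => simp only [truncatedInterleave, Circuit.queryCount_append, ih]; rfl

theorem exists_eval_truncatedInterleave (g : (Fin P → Fin 2) → ℕ → Matrix.unitaryGroup m ℂ)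
    (S : Matrix m m ℂ) (k : ℕ) :
    ∃ u : (Fin (P + 1) → Fin 2) → Matrix m m ℂ,
      Circuit.eval (controlled S) (truncatedInterleave g k) = select u ∧
        ∀ b, u (Fin.cons 0 b) = interleave S (g b) (min k (hammingNorm b)) := by
  induction k with
  | zero => exact ⟨_, by simp [truncatedInterleave, Circuit.eval, Gate.eval, selectGate]; rfl,
      fun b => by simp [interleave]⟩
  | succ k ih =>
    obtain ⟨u, hu, hu0⟩ := ih
    refine ⟨_, by
      simp only [truncatedInterleave, Circuit.eval_append, hu, Circuit.eval, Gate.eval, selectGate,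
        eval_permutedQuery _ (rfl : controlled S 0 = select _), one_mul, select_mul_select]; rfl,
      fun b => ?_⟩
    simp only [Function.comp_apply, thresholdFlip_cons_zero, hu0, Fin.tail_cons]
    by_cases hb : k < hammingNorm b
    · simp [hb, min_eq_left hb.le, interleave, Matrix.mul_assoc]
    · simp [hb, min_eq_right (not_lt.mp hb), min_eq_right ((not_lt.mp hb).trans k.le_succ)]

end Truncate

section LinearCombination

variable {P : ℕ} {m : Type*} [Fintype m] [DecidableEq m]

theorem eval_conj_registerGate {B q : Type*} [Fintype B] [DecidableEq B]
    (A A' : Matrix.unitaryGroup B ℂ) (C : Circuit (B × m) q)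
    (o : q → Matrix (B × m) (B × m) ℂ) :
    Circuit.eval o (registerGate A :: C ++ [registerGate A']) =
      (A' : Matrix B B ℂ) ⊗ₖ (1 : Matrix m m ℂ) * C.eval o *
        (A : Matrix B B ℂ) ⊗ₖ (1 : Matrix m m ℂ) := by
  simp [Circuit.eval_append, Circuit.eval, Gate.eval, registerGate, Matrix.mul_assoc]

theorem exists_circuit_block_eq_affine (P : ℕ) (z : Fin 2 → ℂ) (hz : 0 < ∑ h, ‖z h‖)
    (U : Matrix.unitaryGroup m ℂ) :
    ∃ C : Circuit ((Fin (P + 1) → Fin 2) × m) (Fin (P + 1)), C.queryCount = 1 ∧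
      ∀ S : Matrix m m ℂ,
        block (C.eval (controlled S)) 0 0 =
          ((∑ h, ‖z h‖ : ℝ) : ℂ)⁻¹ • ((z 0 • 1 + z 1 • S) * (U : Matrix m m ℂ)) ∧
        ∀ c, Fin.tail c ≠ 0 → block (C.eval (controlled S)) c 0 = 0 := by
  obtain ⟨G, G', hG⟩ := exists_unitary_row_mul_col_eq z hz 0
  refine ⟨registerGate (headTail G 1) :: [selectGate fun _ => U, .query 0] ++
    [registerGate (headTail G' 1)], rfl, fun S => ?_⟩
  have eval_eq : Circuit.eval (controlled S)
      ([selectGate fun _ => U, .query 0] : Circuit ((Fin (P + 1) → Fin 2) × m) (Fin (P + 1))) =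
        select fun b => (if b 0 = 0 then 1 else S) * (U : Matrix m m ℂ) := by
    simp [Circuit.eval, Gate.eval, selectGate, controlled, select_mul_select]
  simp only [eval_conj_registerGate, eval_eq, block_conj_headTail_one]
  refine ⟨?_, fun c hc => if_neg hc⟩
  simp [tail_zero, hG, mul_smul, add_mul]

theorem exists_circuit_block_eq_sum_truncated (w : (Fin P → Fin 2) → ℂ) (hw : 0 < ∑ b, ‖w b‖)
    (g : (Fin P → Fin 2) → ℕ → Matrix.unitaryGroup m ℂ) (k : ℕ) :
    ∃ C : Circuit ((Fin (P + 1) → Fin 2) × m) (Fin (P + 1)), C.queryCount = k ∧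
      ∀ S : Matrix m m ℂ,
        block (C.eval (controlled S)) 0 0 = ((∑ b, ‖w b‖ : ℝ) : ℂ)⁻¹ •
          ∑ b, w b • interleave S (g b) (min k (hammingNorm b)) ∧
        ∀ c, c 0 ≠ 0 → block (C.eval (controlled S)) 0 c = 0 := by
  obtain ⟨V, V', hV⟩ := exists_unitary_row_mul_col_eq w hw 0
  refine ⟨registerGate (headTail 1 V) :: truncatedInterleave g k ++
    [registerGate (headTail 1 V')], ?_, fun S => ?_⟩
  · rw [Circuit.queryCount_append]
    exact queryCount_truncatedInterleave g k
  obtain ⟨u, hu, hu0⟩ := exists_eval_truncatedInterleave g S k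
  simp only [eval_conj_registerGate, hu, block_conj_one_headTail, hu0]
  refine ⟨?_, fun c hc => if_neg hc⟩
  simp [tail_zero, hV, mul_smul, Finset.smul_sum]

theorem exists_circuit_block_eq_sum_truncated_mul_affine (z : Fin 2 → ℂ) (hz : 0 < ∑ h, ‖z h‖)
    (U : Matrix.unitaryGroup m ℂ) (w : (Fin P → Fin 2) → ℂ) (hw : 0 < ∑ b, ‖w b‖)
    (g : (Fin P → Fin 2) → ℕ → Matrix.unitaryGroup m ℂ) (k : ℕ) :
    ∃ C : Circuit ((Fin (P + 1) → Fin 2) × m) (Fin (P + 1)), C.queryCount = k + 1 ∧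
      ∀ S : Matrix m m ℂ,
        ((∑ b, ‖w b‖) * ∑ h, ‖z h‖) • block (C.eval (controlled S)) 0 0 =
          (∑ b, w b • interleave S (g b) (min k (hammingNorm b))) * (z 0 • 1 + z 1 • S) * U := by
  obtain ⟨E, hE, hE0⟩ := exists_circuit_block_eq_affine P z hz U
  obtain ⟨F, hF, hF0⟩ := exists_circuit_block_eq_sum_truncated w hw g k
  refine ⟨E ++ F, by rw [Circuit.queryCount_append, hE, hF, add_comm], fun S => ?_⟩
  have block_eq : block (F.eval (controlled S) * E.eval (controlled S)) 0 0 =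
      block (F.eval (controlled S)) 0 0 * block (E.eval (controlled S)) 0 0 := by
    rw [block_mul]
    refine Finset.sum_eq_single 0 (fun c _ hc => ?_) (by simp)
    by_cases hc0 : c 0 = 0
    · rw [(hE0 S).2 c fun hct => hc (funext (Fin.cases hc0 (congrFun hct))), mul_zero]
    · rw [(hF0 S).2 c hc0, zero_mul]
  have hz' : ((∑ h, ‖z h‖ : ℝ) : ℂ) ≠ 0 := Complex.ofReal_ne_zero.mpr hz.ne'
  have hw' : ((∑ b, ‖w b‖ : ℝ) : ℂ) ≠ 0 := Complex.ofReal_ne_zero.mpr hw.ne'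
  rw [Circuit.eval_append, block_eq, (hE0 S).1, (hF0 S).1, smul_mul_smul_comm, ← Complex.coe_smul,
    smul_smul, Complex.ofReal_mul, ← mul_inv, mul_inv_cancel₀ (mul_ne_zero hw' hz'), one_smul,
    Matrix.mul_assoc]

end LinearCombination

section Chernoff

theorem sum_pow_hammingNorm_mul_prod {ι R : Type*} [Fintype ι] [DecidableEq ι] [CommSemiring R]
    (f : ι → Fin 2 → R) (t : R) :
    ∑ b, t ^ hammingNorm b * ∏ i, f i (b i) = ∏ i, (f i 0 + t * f i 1) := by
  have expand := Finset.prod_univ_sum (fun _ : ι => (Finset.univ : Finset (Fin 2)))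
    fun i h => (if h = 0 then 1 else t) * f i h
  simp only [Fin.sum_univ_two, Fintype.piFinset_univ, Finset.prod_mul_distrib] at expand
  simpa [hammingNorm, Finset.prod_ite] using expand.symm

variable {ι : Type*} [Fintype ι] [DecidableEq ι] {f : ι → Fin 2 → ℝ} {y t : ℝ}

theorem sum_pow_hammingNorm_mul_prod_le (hf : ∀ i h, 0 ≤ f i h) (hf0 : ∀ i, f i 0 ≤ 1)
    (hf1 : ∀ i, f i 1 ≤ y) (ht : 0 ≤ t) :
    ∑ b, t ^ hammingNorm b * ∏ i, f i (b i) ≤ Real.exp (Fintype.card ι * (t * y)) := by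
  calc ∑ b, t ^ hammingNorm b * ∏ i, f i (b i) = ∏ i, (f i 0 + t * f i 1) :=
        sum_pow_hammingNorm_mul_prod f t
    _ ≤ ∏ _i : ι, Real.exp (t * y) := by
        refine Finset.prod_le_prod
          (fun i _ => add_nonneg (hf i 0) (mul_nonneg ht (hf i 1))) fun i _ => ?_
        linarith [hf0 i, mul_le_mul_of_nonneg_left (hf1 i) ht, Real.add_one_le_exp (t * y)]
    _ = Real.exp (Fintype.card ι * (t * y)) := by
        rw [Finset.prod_const, Finset.card_univ, Real.exp_nat_mul]

theorem sum_lt_hammingNorm_prod_le (hf : ∀ i h, 0 ≤ f i h) (hf0 : ∀ i, f i 0 ≤ 1)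
    (hf1 : ∀ i, f i 1 ≤ y) (ht : 1 ≤ t) (k : ℕ) :
    ∑ b with k < hammingNorm b, ∏ i, f i (b i) ≤
      Real.exp (Fintype.card ι * (t * y)) / t ^ (k + 1) := by
  have prod_nonneg (b : ι → Fin 2) : 0 ≤ ∏ i, f i (b i) := Finset.prod_nonneg fun i _ => hf i (b i)
  rw [le_div_iff₀' (by positivity), Finset.mul_sum]
  calc ∑ b with k < hammingNorm b, t ^ (k + 1) * ∏ i, f i (b i)
      ≤ ∑ b : ι → Fin 2 with k < hammingNorm b, t ^ hammingNorm b * ∏ i, f i (b i) := by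
        refine Finset.sum_le_sum fun b hb => mul_le_mul_of_nonneg_right ?_ (prod_nonneg b)
        exact pow_le_pow_right₀ ht (Finset.mem_filter.mp hb).2
    _ ≤ ∑ b, t ^ hammingNorm b * ∏ i, f i (b i) :=
        Finset.sum_le_sum_of_subset_of_nonneg (Finset.filter_subset _ _)
          fun b _ _ => mul_nonneg (by positivity) (prod_nonneg b)
    _ ≤ Real.exp (Fintype.card ι * (t * y)) :=
        sum_pow_hammingNorm_mul_prod_le hf hf0 hf1 (zero_le_one.trans ht)

end Chernoff

section Truncation

open scoped Matrix.Norms.L2Operator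

variable {P : ℕ} {m q : Type*} [Fintype m] [DecidableEq m]

theorem norm_sum_interleave_min_sub_le (w : (Fin P → Fin 2) → ℂ)
    (g : (Fin P → Fin 2) → ℕ → Matrix.unitaryGroup m ℂ) {S : Matrix m m ℂ} (hS : ‖S‖ ≤ 1) (k : ℕ) :
    ‖∑ b, w b • interleave S (g b) (min k (hammingNorm b)) -
        ∑ b, w b • interleave S (g b) (hammingNorm b)‖ ≤
      2 * ∑ b with k < hammingNorm b, ‖w b‖ := by
  rw [← Finset.sum_sub_distrib, Finset.mul_sum, Finset.sum_filter]
  refine norm_sum_le_of_le _ fun b _ => ?_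
  rw [← smul_sub, norm_smul]
  split_ifs with hb
  · rw [mul_comm]
    gcongr
    calc _ ≤ ‖interleave S (g b) (min k (hammingNorm b))‖ + ‖interleave S (g b) (hammingNorm b)‖ :=
          norm_sub_le _ _
      _ ≤ 2 := by
          linarith [norm_interleave_le_one hS (g b) (min k (hammingNorm b)),
            norm_interleave_le_one hS (g b) (hammingNorm b)]
  · rw [min_eq_right (not_lt.mp hb), sub_self, norm_zero, mul_zero]

theorem norm_truncated_mul_mul_sub_le (w : (Fin P → Fin 2) → ℂ)
    (g : (Fin P → Fin 2) → ℕ → Matrix.unitaryGroup m ℂ) {S A B : Matrix m m ℂ} (hS : ‖S‖ ≤ 1)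
    (hA : ‖A‖ ≤ 1) (hB : ‖B‖ ≤ 1) (k : ℕ) :
    ‖(∑ b, w b • interleave S (g b) (min k (hammingNorm b))) * A * B -
        (∑ b, w b • interleave S (g b) (hammingNorm b)) * A * B‖ ≤
      2 * ∑ b with k < hammingNorm b, ‖w b‖ := by
  rw [← sub_mul, ← sub_mul]
  calc _ ≤ ‖∑ b, w b • interleave S (g b) (min k (hammingNorm b)) -
          ∑ b, w b • interleave S (g b) (hammingNorm b)‖ * ‖A‖ * ‖B‖ := norm_mul₃_le
    _ ≤ (2 * ∑ b with k < hammingNorm b, ‖w b‖) * 1 * 1 := by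
        gcongr
        exact norm_sum_interleave_min_sub_le w g hS k
    _ = _ := by rw [mul_one, mul_one]

theorem sum_norm_prod_le {z : q → Fin 2 → ℂ} {y : ℝ} (hz0 : ∀ a, ‖z a 0‖ ≤ 1)
    (hz1 : ∀ a, ‖z a 1‖ ≤ y) (l : Fin P → q) :
    ∑ b : Fin P → Fin 2, ‖∏ i, z (l i) (b i)‖ ≤ Real.exp (P * y) := by
  simpa [norm_prod] using sum_pow_hammingNorm_mul_prod_le (f := fun i h => ‖z (l i) h‖)
    (fun _ _ => norm_nonneg _) (fun i => hz0 (l i)) (fun i => hz1 (l i)) zero_le_one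

theorem sum_norm_prod_mul_sum_norm_le {z : q → Fin 2 → ℂ} {y : ℝ} (hz0 : ∀ a, ‖z a 0‖ ≤ 1)
    (hz1 : ∀ a, ‖z a 1‖ ≤ y) (l : Fin P → q) (a : q) :
    (∑ b : Fin P → Fin 2, ‖∏ i, z (l i) (b i)‖) * ∑ h, ‖z a h‖ ≤ Real.exp ((P + 1 : ℕ) * y) := by
  calc (∑ b : Fin P → Fin 2, ‖∏ i, z (l i) (b i)‖) * ∑ h, ‖z a h‖
      ≤ Real.exp (P * y) * Real.exp y := by
        gcongr
        · exact sum_norm_prod_le hz0 hz1 l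
        · rw [Fin.sum_univ_two]
          linarith [hz0 a, hz1 a, Real.add_one_le_exp y]
    _ = Real.exp ((P + 1 : ℕ) * y) := by rw [← Real.exp_add]; push_cast; ring_nf

theorem sum_lt_hammingNorm_norm_prod_le {z : q → Fin 2 → ℂ} {y t : ℝ} (hz0 : ∀ a, ‖z a 0‖ ≤ 1)
    (hz1 : ∀ a, ‖z a 1‖ ≤ y) (ht : 1 ≤ t) (l : Fin P → q) (k : ℕ) :
    ∑ b : Fin P → Fin 2 with k < hammingNorm b, ‖∏ i, z (l i) (b i)‖ ≤
      Real.exp (P * (t * y)) / t ^ (k + 1) := by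
  simpa [norm_prod] using sum_lt_hammingNorm_prod_le (f := fun i h => ‖z (l i) h‖)
    (fun _ _ => norm_nonneg _) (fun i => hz0 (l i)) (fun i => hz1 (l i)) ht k

theorem sum_norm_pos {ι E : Type*} [Fintype ι] [NormedAddCommGroup E] {v : ι → E} (hv : v ≠ 0) :
    0 < ∑ i, ‖v i‖ := by
  obtain ⟨i, hi⟩ := Function.ne_iff.mp hv
  exact Finset.sum_pos' (fun _ _ => norm_nonneg _) ⟨i, Finset.mem_univ i, norm_pos_iff.mpr hi⟩

theorem Circuit.exists_truncation {Q : ℕ} (C : Circuit m q) (hC : C.queryCount = Q)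
    {z : q → Fin 2 → ℂ} {y t : ℝ} (hz : ∀ a, z a ≠ 0) (hz0 : ∀ a, ‖z a 0‖ ≤ 1)
    (hz1 : ∀ a, ‖z a 1‖ ≤ y) (ht : 1 ≤ t) (k : ℕ) :
    ∃ (C' : Circuit ((Fin Q → Fin 2) × m) (Fin Q)) (N : ℝ), C'.queryCount ≤ k + 1 ∧
      0 < N ∧ N ≤ Real.exp (Q * y) ∧
      ∀ (S : Matrix m m ℂ) (o : q → Matrix m m ℂ), ‖S‖ ≤ 1 →
        (∀ a, o a = z a 0 • (1 : Matrix m m ℂ) + z a 1 • S) → (∀ a, ‖o a‖ ≤ 1) →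
          ‖N • block (C'.eval (controlled S)) 0 0 - C.eval o‖ ≤
            2 * (Real.exp (Q * (t * y)) / t ^ (k + 1)) := by
  cases Q with
  | zero =>
    obtain ⟨U, hU⟩ := C.exists_unitary_of_queryCount_eq_zero hC
    refine ⟨[selectGate fun _ => U], 1, by simp [selectGate, Circuit.queryCount], one_pos, by simp,
      fun S o _ _ _ => ?_⟩
    simp only [Circuit.eval, Gate.eval, selectGate, one_mul, block_select, if_true, hU,
      one_smul, sub_self, norm_zero]
    positivity
  | succ P =>
    obtain ⟨U, a, D, hD, hCD⟩ := C.exists_first_query hC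
    obtain ⟨l, g, hg⟩ := D.exists_eval_eq_sum_interleave hD
    have hy : 0 ≤ y := (norm_nonneg _).trans (hz1 a)
    set w : (Fin P → Fin 2) → ℂ := fun b => ∏ i, z (l i) (b i)
    have hw : w ≠ 0 := by
      choose h hh using fun a => Function.ne_iff.mp (hz a)
      exact Function.ne_iff.mpr ⟨fun i => h (l i), Finset.prod_ne_zero_iff.mpr fun i _ => hh (l i)⟩
    obtain ⟨C', hC', hblock⟩ := exists_circuit_block_eq_sum_truncated_mul_affine
      (z a) (sum_norm_pos (hz a)) U w (sum_norm_pos hw) g k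
    refine ⟨C', (∑ b, ‖w b‖) * ∑ h, ‖z a h‖, hC'.le,
      mul_pos (sum_norm_pos hw) (sum_norm_pos (hz a)), sum_norm_prod_mul_sum_norm_le hz0 hz1 l a,
      fun S o hS ho ho1 => ?_⟩
    rw [hblock S, hCD, hg o S z ho, ← ho]
    refine (norm_truncated_mul_mul_sub_le w g hS (ho1 a) (norm_unitary_le_one U) k).trans ?_
    gcongr
    refine (sum_lt_hammingNorm_norm_prod_le hz0 hz1 ht l k).trans ?_
    gcongr
    exact P.le_succ

end Truncation

section FracPow

/-- The coefficients of `I` and `R` in `R ^ s`. -/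
def fracCoeff (s : ℝ) : Fin 2 → ℂ :=
  ![(1 + Complex.exp (-(Complex.I * Real.pi * s))) / 2,
    (1 - Complex.exp (-(Complex.I * Real.pi * s))) / 2]

theorem fracCoeff_ne_zero (s : ℝ) : fracCoeff s ≠ 0 := fun h => by
  have sum_eq_one : fracCoeff s 0 + fracCoeff s 1 = 1 := by
    simp only [fracCoeff, Matrix.cons_val_zero, Matrix.cons_val_one]
    ring
  simp [h] at sum_eq_one

theorem neg_I_mul_pi_mul (s : ℝ) :
    -(Complex.I * Real.pi * s) = Complex.I * (-(Real.pi * s) : ℝ) := by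
  push_cast
  ring

theorem norm_fracCoeff_zero_le (s : ℝ) : ‖fracCoeff s 0‖ ≤ 1 := by
  have norm_exp : ‖Complex.exp (-(Complex.I * Real.pi * s))‖ = 1 := by
    rw [neg_I_mul_pi_mul, mul_comm, Complex.norm_exp_ofReal_mul_I]
  calc ‖fracCoeff s 0‖ = ‖1 + Complex.exp (-(Complex.I * Real.pi * s))‖ / 2 := by simp [fracCoeff]
    _ ≤ (‖(1 : ℂ)‖ + ‖Complex.exp (-(Complex.I * Real.pi * s))‖) / 2 := by
        gcongr
        exact norm_add_le _ _
    _ = 1 := by rw [norm_exp, norm_one]; norm_num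

theorem norm_fracCoeff_one_le (s : ℝ) : ‖fracCoeff s 1‖ ≤ Real.pi * |s| / 2 := by
  calc ‖fracCoeff s 1‖ = ‖Complex.exp (Complex.I * (-(Real.pi * s) : ℝ)) - 1‖ / 2 := by
        rw [← neg_I_mul_pi_mul, norm_sub_rev]
        simp [fracCoeff]
    _ ≤ ‖-(Real.pi * s)‖ / 2 := by gcongr; exact Real.norm_exp_I_mul_ofReal_sub_one_le
    _ = Real.pi * |s| / 2 := by
        rw [norm_neg, norm_mul, Real.norm_eq_abs, Real.norm_eq_abs, abs_of_pos Real.pi_pos]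

theorem norm_fracCoeff_cond_le {s : ℝ} (hs : 0 ≤ s) (a : Bool) :
    ‖fracCoeff (bif a then -s else s) 1‖ ≤ Real.pi * s / 2 := by
  refine (norm_fracCoeff_one_le _).trans_eq ?_
  cases a <;> simp [abs_of_nonneg hs]

theorem star_fracCoeff (s : ℝ) (h : Fin 2) : star (fracCoeff s h) = fracCoeff (-s) h := by
  fin_cases h <;> simp [fracCoeff, ← Complex.exp_conj]

variable {d : ℕ} {R : Matrix (Fin d) (Fin d) ℂ}

theorem fracPow_eq (R : Matrix (Fin d) (Fin d) ℂ) (s : ℝ) :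
    fracPow R s = fracCoeff s 0 • (1 : Matrix (Fin d) (Fin d) ℂ) + fracCoeff s 1 • R := by
  simp only [fracPow, fracCoeff, Matrix.cons_val_zero, Matrix.cons_val_one]
  module

theorem fracPow_zero (R : Matrix (Fin d) (Fin d) ℂ) : fracPow R 0 = 1 := by
  simp [fracPow_eq, fracCoeff]

theorem fracPow_mul (hRR : R * R = 1) (s t : ℝ) :
    fracPow R s * fracPow R t = fracPow R (s + t) := by
  have exp_add : Complex.exp (-(Complex.I * Real.pi * (s + t : ℝ))) =
      Complex.exp (-(Complex.I * Real.pi * s)) * Complex.exp (-(Complex.I * Real.pi * t)) := by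
    rw [← Complex.exp_add]
    push_cast
    ring_nf
  simp only [fracPow_eq, fracCoeff, Matrix.cons_val_zero, Matrix.cons_val_one, exp_add, add_mul,
    mul_add, smul_mul_smul_comm, hRR, one_mul, mul_one]
  module

theorem conjTranspose_fracPow (hR : R.IsHermitian) (s : ℝ) :
    (fracPow R s)ᴴ = fracPow R (-s) := by
  simp only [fracPow_eq, Matrix.conjTranspose_add, Matrix.conjTranspose_smul, star_fracCoeff,
    Matrix.conjTranspose_one, hR.eq]

theorem fracPow_mem_unitaryGroup (hR : R.IsHermitian) (hRR : R * R = 1) (s : ℝ) :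
    fracPow R s ∈ Matrix.unitaryGroup (Fin d) ℂ := by
  rw [Matrix.mem_unitaryGroup_iff, Matrix.star_eq_conjTranspose, conjTranspose_fracPow hR,
    fracPow_mul hRR, add_neg_cancel, fracPow_zero]

variable {W : Type*} [DecidableEq W]

theorem fracOracle_fracPow (hR : R.IsHermitian) (s : ℝ) (a : Bool) :
    fracOracle (fracPow R s) a =
      fracCoeff (bif a then -s else s) 0 • (1 : Matrix (Fin d × W) (Fin d × W) ℂ) +
        fracCoeff (bif a then -s else s) 1 • R ⊗ₖ (1 : Matrix W W ℂ) := by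
  cases a
  · simp only [fracOracle, fracPow_eq, Matrix.add_kronecker, Matrix.smul_kronecker,
      Matrix.one_kronecker_one, cond_false]
  · rw [fracOracle, conjTranspose_fracPow hR]
    simp only [fracPow_eq, Matrix.add_kronecker, Matrix.smul_kronecker, Matrix.one_kronecker_one,
      cond_true]

theorem fracOracle_mem_unitaryGroup [Fintype W] {Z : Matrix (Fin d) (Fin d) ℂ}
    (hZ : Z ∈ Matrix.unitaryGroup (Fin d) ℂ) (a : Bool) :
    fracOracle Z a ∈ Matrix.unitaryGroup (Fin d × W) ℂ := by
  cases a with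
  | false => exact Matrix.kronecker_mem_unitary hZ (one_mem _)
  | true => exact Matrix.kronecker_mem_unitary (Unitary.star_mem hZ) (one_mem _)

theorem ctrlOracle_eq_controlled (Q : ℕ) (R : Matrix (Fin d) (Fin d) ℂ) :
    ctrlOracle (W := W) Q R = controlled (R ⊗ₖ (1 : Matrix W W ℂ)) := by
  funext i
  ext ⟨b, x⟩ ⟨c, y⟩
  obtain rfl | hbc := eq_or_ne b c
  · obtain h | h : b i = 0 ∨ b i = 1 := by omega
    all_goals simp [ctrlOracle, controlled, select, h]
  · simp [ctrlOracle, controlled, select, hbc]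

end FracPow

section Postselection

theorem norm_normalize_sub_le {V : Type*} [NormedAddCommGroup V] [NormedSpace ℝ V] {u : V}
    (hu : ‖u‖ = 1) (v : V) : ‖NormedSpace.normalize v - u‖ ≤ 2 * ‖v - u‖ := by
  have norm_normalize_sub_self : ‖NormedSpace.normalize v - v‖ ≤ ‖v - u‖ := by
    obtain rfl | hv := eq_or_ne v 0
    · simp
    calc ‖NormedSpace.normalize v - v‖ = ‖(‖v‖⁻¹ - 1) • v‖ := by
          rw [NormedSpace.normalize, sub_smul, one_smul]
      _ = |‖u‖ - ‖v‖| := by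
          rw [norm_smul, Real.norm_eq_abs, ← abs_norm v, ← abs_mul, abs_norm, sub_mul,
            inv_mul_cancel₀ (norm_ne_zero_iff.mpr hv), one_mul, hu]
      _ ≤ ‖v - u‖ := by
          rw [norm_sub_rev]
          exact abs_norm_sub_norm_le u v
  linarith [norm_sub_le_norm_sub_add_norm_sub (NormedSpace.normalize v) v u]

variable {m : Type*} {Q : ℕ}

theorem zeroBra_sub_smul_zeroKet (Ψ : EuclideanSpace ℂ ((Fin Q → Fin 2) × m)) (ν : ℂ)
    (v : EuclideanSpace ℂ m) : zeroBra Q (Ψ - ν • zeroKet Q v) = zeroBra Q Ψ - ν • v := by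
  ext x
  simp [zeroBra, zeroKet]

variable [Fintype m]

open scoped Matrix.Norms.L2Operator in
theorem norm_act_le [DecidableEq m] (M : Matrix m m ℂ) (v : EuclideanSpace ℂ m) :
    ‖act M v‖ ≤ ‖M‖ * ‖v‖ :=
  Matrix.l2_opNorm_mulVec M v

open scoped Matrix.Norms.L2Operator in
theorem norm_act_of_mem_unitaryGroup [DecidableEq m] {M : Matrix m m ℂ}
    (hM : M ∈ Matrix.unitaryGroup m ℂ) (v : EuclideanSpace ℂ m) : ‖act M v‖ = ‖v‖ := by
  have norm_act_le_of_mem {U : Matrix m m ℂ} (hU : U ∈ Matrix.unitaryGroup m ℂ)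
      (u : EuclideanSpace ℂ m) : ‖act U u‖ ≤ ‖u‖ :=
    (norm_act_le U u).trans
      (mul_le_of_le_one_left (norm_nonneg u) (norm_unitary_le_one ⟨U, hU⟩))
  refine (norm_act_le_of_mem hM v).antisymm ?_
  calc ‖v‖ = ‖act (star M) (act M v)‖ := by
        simp [act, Matrix.mulVec_mulVec, Unitary.star_mul_self_of_mem hM]
    _ ≤ ‖act M v‖ := norm_act_le_of_mem (Unitary.star_mem hM) _

theorem zeroBra_act_zeroKet
    (M : Matrix ((Fin Q → Fin 2) × m) ((Fin Q → Fin 2) × m) ℂ) (v : EuclideanSpace ℂ m) :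
    zeroBra Q (act M (zeroKet Q v)) = act (block M 0 0) v := by
  ext x
  simp [zeroBra, act, zeroKet, block, Matrix.mulVec, dotProduct, Fintype.sum_prod_type]

open scoped Matrix.Norms.L2Operator in
theorem norm_smul_zeroBra_act_zeroKet_sub_le [DecidableEq m] (N : ℝ)
    (M : Matrix ((Fin Q → Fin 2) × m) ((Fin Q → Fin 2) × m) ℂ) (A : Matrix m m ℂ)
    (v : EuclideanSpace ℂ m) :
    ‖N • zeroBra Q (act M (zeroKet Q v)) - act A v‖ ≤ ‖N • block M 0 0 - A‖ * ‖v‖ := by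
  have act_eq : N • zeroBra Q (act M (zeroKet Q v)) - act A v = act (N • block M 0 0 - A) v := by
    rw [zeroBra_act_zeroKet]
    ext x
    simp [act, Matrix.sub_mulVec, Matrix.smul_mulVec]
  exact act_eq ▸ norm_act_le _ v

theorem exists_postselected (Ψ : EuclideanSpace ℂ ((Fin Q → Fin 2) × m)) {u : EuclideanSpace ℂ m}
    (hu : ‖u‖ = 1) {N δ : ℝ} (hN : 0 < N) (hΨ : ‖N • zeroBra Q Ψ - u‖ ≤ δ) (hδ : δ < 1) :
    ∃ (ν : ℂ) (out : EuclideanSpace ℂ m) (Φ : EuclideanSpace ℂ ((Fin Q → Fin 2) × m)),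
      Ψ = ν • zeroKet Q out + Φ ∧ ‖out‖ = 1 ∧ zeroBra Q Φ = 0 ∧ (1 - δ) / N ≤ ‖ν‖ ∧
        ‖out - u‖ ≤ 2 * δ := by
  set p := zeroBra Q Ψ
  have le_norm : 1 - δ ≤ N * ‖p‖ := by
    have := norm_sub_norm_le u (N • p)
    rw [norm_sub_rev, hu, norm_smul, Real.norm_of_nonneg hN.le] at this
    linarith
  have hp0 : p ≠ 0 := by
    rintro h
    rw [h, norm_zero, mul_zero] at le_norm
    linarith
  refine ⟨(‖p‖ : ℂ), NormedSpace.normalize p, Ψ - (‖p‖ : ℂ) • zeroKet Q (NormedSpace.normalize p),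
    (add_sub_cancel _ _).symm, NormedSpace.norm_normalize_eq_one_iff.mpr hp0, ?_, ?_, ?_⟩
  · rw [zeroBra_sub_smul_zeroKet, Complex.coe_smul, NormedSpace.norm_smul_normalize, sub_self]
  · rw [Complex.norm_real, norm_norm, div_le_iff₀' hN]
    exact le_norm
  · rw [← NormedSpace.normalize_smul_of_pos hN]
    exact (norm_normalize_sub_le hu _).trans (by gcongr)

end Postselection

section Numerics

theorem four_mul_exp_div_exp_pow_lt {α : ℝ} (hα : 0 ≤ α) {Q k : ℕ}
    (hk : 49 + 100 * α * Q ≤ k + 1) :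
    4 * (Real.exp (Q * (Real.exp 4 * (Real.pi * α / 2))) / Real.exp 4 ^ (k + 1)) <
      Real.exp (-(99 * α * Real.pi * Q) - 20) := by
  have exp_four_lt : Real.exp 4 < 54.6 := by
    calc Real.exp 4 = Real.exp 1 ^ 4 := by rw [← Real.exp_nat_mul]; norm_num
      _ < 2.7182818286 ^ 4 := by gcongr; exact Real.exp_one_lt_d9
      _ < 54.6 := by norm_num
  have exponent_lt : 3 + (Q * (Real.exp 4 * (Real.pi * α / 2)) - (k + 1 : ℕ) * 4) <
      -(99 * α * Real.pi * Q) - 20 := by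
    have hx : 0 ≤ α * Q := by positivity
    have main : Q * (Real.exp 4 * (Real.pi * α / 2)) ≤ 54.6 * (Real.pi * (α * Q) / 2) := by
      calc Q * (Real.exp 4 * (Real.pi * α / 2)) = Real.exp 4 * (Real.pi * (α * Q) / 2) := by ring
        _ ≤ 54.6 * (Real.pi * (α * Q) / 2) := by gcongr
    have hpi : Real.pi * (α * Q) ≤ 3.1416 * (α * Q) := by gcongr; exact Real.pi_lt_d4.le
    push_cast
    linarith
  calc 4 * (Real.exp (Q * (Real.exp 4 * (Real.pi * α / 2))) / Real.exp 4 ^ (k + 1))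
      ≤ Real.exp 3 * (Real.exp (Q * (Real.exp 4 * (Real.pi * α / 2))) / Real.exp 4 ^ (k + 1)) := by
        gcongr
        linarith [Real.add_one_le_exp 3]
    _ = Real.exp (3 + (Q * (Real.exp 4 * (Real.pi * α / 2)) - (k + 1 : ℕ) * 4)) := by
        rw [Real.exp_add, Real.exp_sub, Real.exp_nat_mul 4 (k + 1)]
    _ < Real.exp (-(99 * α * Real.pi * Q) - 20) := Real.exp_lt_exp.mpr exponent_lt

theorem exp_neg_sub_twenty_le {x : ℝ} (hx : 0 ≤ x) : Real.exp (-x - 20) ≤ 0.02 := by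
  calc Real.exp (-x - 20) ≤ (Real.exp 20)⁻¹ := by
        rw [← Real.exp_neg]
        exact Real.exp_le_exp.mpr (by linarith)
    _ ≤ (1 + 20 + 20 ^ 2 / 2)⁻¹ := by
        gcongr
        exact Real.quadratic_le_exp_of_nonneg (by norm_num)
    _ ≤ 0.02 := by norm_num

theorem exp_neg_le_one_sub_div {x N δ : ℝ} (hN : 0 < N) (hNx : N ≤ Real.exp x) (hδ : δ ≤ 0.01) :
    0.99 * Real.exp (-x) ≤ (1 - δ) / N := by
  rw [Real.exp_neg, ← div_eq_mul_inv]
  exact div_le_div₀ (by linarith) (by linarith) hN hNx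

end Numerics

end QueryCircuit

end

theorem lemma4p4_general {d : ℕ} {W : Type*} [Fintype W] [DecidableEq W] (Q : ℕ) (α : ℝ)
    (hα : 0 ≤ α)
    (C : QueryCircuit.Circuit (Fin d × W) Bool)
    (hC : QueryCircuit.Circuit.queryCount C = Q) :
    ∃ C' : QueryCircuit.Circuit ((Fin Q → Fin 2) × (Fin d × W)) (Fin Q),
      (QueryCircuit.Circuit.queryCount C' : ℝ) ≤ 50 + 100 * α * (Q : ℝ) ∧
      ∀ R : Matrix (Fin d) (Fin d) ℂ, R ∈ Matrix.unitaryGroup (Fin d) ℂ → R * R = 1 →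
        ∀ ψ : EuclideanSpace ℂ (Fin d × W), ‖ψ‖ = 1 →
          ∃ (ν : ℂ) (out : EuclideanSpace ℂ (Fin d × W))
            (Φ : EuclideanSpace ℂ ((Fin Q → Fin 2) × (Fin d × W))),
            QueryCircuit.act
                (QueryCircuit.Circuit.eval (QueryCircuit.ctrlOracle Q R) C')
                (QueryCircuit.zeroKet Q ψ) = ν • QueryCircuit.zeroKet Q out + Φ ∧
            ‖out‖ = 1 ∧
            QueryCircuit.zeroBra Q Φ = 0 ∧
            0.99 * Real.exp (-(α * Real.pi * ((Q : ℝ) / 2))) ≤ ‖ν‖ ∧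
            ‖out - QueryCircuit.act
                (QueryCircuit.Circuit.eval
                  (QueryCircuit.fracOracle (QueryCircuit.fracPow R α)) C) ψ‖
              < Real.exp (-(99 * α * Real.pi * (Q : ℝ)) - 20) := by
  open QueryCircuit in
  set k := ⌊49 + 100 * α * Q⌋₊
  have hk : k + 1 ≤ 50 + 100 * α * Q := by
    linarith [Nat.floor_le (show 0 ≤ 49 + 100 * α * Q by positivity)]
  have hδ := four_mul_exp_div_exp_pow_lt hα (Nat.lt_floor_add_one (49 + 100 * α * Q)).le
  have hδ1 : Real.exp (-(99 * α * Real.pi * Q) - 20) ≤ 0.02 :=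
    exp_neg_sub_twenty_le (by positivity)
  obtain ⟨C', N, hcount, hN, hNle, hC'⟩ := C.exists_truncation hC
    (fun a => fracCoeff_ne_zero (bif a then -α else α)) (fun a => norm_fracCoeff_zero_le _)
    (norm_fracCoeff_cond_le hα) (Real.one_le_exp (zero_le_four (α := ℝ))) k
  refine ⟨C', (Nat.cast_le.mpr hcount).trans (by exact_mod_cast hk), fun R hR hRR ψ hψ => ?_⟩
  have hRH : R.IsHermitian := left_inv_eq_right_inv (Unitary.star_mul_self_of_mem hR) hRR
  have hZ := fracOracle_mem_unitaryGroup (W := W) (fracPow_mem_unitaryGroup hRH hRR α)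
  have herr := hC' (R ⊗ₖ (1 : Matrix W W ℂ)) _
    (norm_unitary_le_one ⟨_, Matrix.kronecker_mem_unitary hR (one_mem _)⟩)
    (fracOracle_fracPow hRH α) fun a => norm_unitary_le_one ⟨_, hZ a⟩
  have hclose := (norm_smul_zeroBra_act_zeroKet_sub_le N _ _ ψ).trans
    (mul_le_mul_of_nonneg_right herr (norm_nonneg ψ))
  rw [hψ, mul_one] at hclose
  obtain ⟨ν, out, Φ, hΨ, hout, hΦ, hν, hle⟩ := exists_postselected _
    ((norm_act_of_mem_unitaryGroup (C.eval_mem_unitaryGroup hZ) ψ).trans hψ) hN hclose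
    (by linarith)
  rw [ctrlOracle_eq_controlled]
  refine ⟨ν, out, Φ, hΨ, hout, hΦ, le_trans ?_ hν, by linarith⟩
  rw [show α * Real.pi * ((Q : ℝ) / 2) = Q * (Real.pi * α / 2) by ring]
  exact exp_neg_le_one_sub_div hN hNle (by linarith)

theorem lemma4p4 {d : ℕ} {W : Type*} [Fintype W] [DecidableEq W] (Q : ℕ) (α : ℝ)
    (hα0 : 0 < α) (hα1 : α ≤ 1)
    (C : QueryCircuit.Circuit (Fin d × W) Bool)
    (hC : QueryCircuit.Circuit.queryCount C = Q) :
    ∃ C' : QueryCircuit.Circuit ((Fin Q → Fin 2) × (Fin d × W)) (Fin Q),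
      (QueryCircuit.Circuit.queryCount C' : ℝ) ≤ 50 + 100 * α * (Q : ℝ) ∧
      ∀ R : Matrix (Fin d) (Fin d) ℂ, R ∈ Matrix.unitaryGroup (Fin d) ℂ → R * R = 1 →
        ∀ ψ : EuclideanSpace ℂ (Fin d × W), ‖ψ‖ = 1 →
          ∃ (ν : ℂ) (out : EuclideanSpace ℂ (Fin d × W))
            (Φ : EuclideanSpace ℂ ((Fin Q → Fin 2) × (Fin d × W))),
            QueryCircuit.act
                (QueryCircuit.Circuit.eval (QueryCircuit.ctrlOracle Q R) C')
                (QueryCircuit.zeroKet Q ψ) = ν • QueryCircuit.zeroKet Q out + Φ ∧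
            ‖out‖ = 1 ∧
            QueryCircuit.zeroBra Q Φ = 0 ∧
            0.99 * Real.exp (-(α * Real.pi * ((Q : ℝ) / 2))) ≤ ‖ν‖ ∧
            ‖out - QueryCircuit.act
                (QueryCircuit.Circuit.eval
                  (QueryCircuit.fracOracle (QueryCircuit.fracPow R α)) C) ψ‖
              < Real.exp (-(99 * α * Real.pi * (Q : ℝ)) - 20) := by
  exact lemma4p4_general Q α hα0.le C hC
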